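/- For a matroid $M$ on a finite ground set $E$ and a field $K$, say that $M$ is representable over $K$ if there is a matrix over $K$ with columns indexed by $E$ such that a subset of $E$ is independent in $M$ if and only if the corresponding columns are linearly independent; $M$ is representable if it is representable over some field. For a representable matroid $M$, let $c(M)$ be the least positive characteristic of a field over which $M$ is representable. For each positive integer $n$, let \[ c(n) = \max\{\, c(M) : M \text{ is a representable matroid on } n \text{ elements} \,\}. \] Then, for every positive integer $n$, \[ \log_2 c(n) \ge \frac{n-7}{2}. \] -/

import Mathlib

universe u

/-- `M` is representable over the field `K`: there is a matrix over `K`, with columns `v e`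
indexed by the elements of `M`, such that the independent sets of `M` are exactly the sets of
elements whose (indexed) families of columns are linearly independent. -/
def MatroidRepresentableOver {α : Type*} (M : Matroid α) (K : Type*) [Field K] : Prop :=
  ∃ (r : ℕ) (v : α → (Fin r → K)), ∀ I ⊆ M.E, (M.Indep I ↔ LinearIndepOn K v I)

/-- `M` is representable over some field. -/
def MatroidRepresentable {α : Type*} (M : Matroid α) : Prop :=
  ∃ (K : Type u) (_ : Field K), MatroidRepresentableOver M K

/-- The positive characteristics of the fields over which `M` is representable. -/
def positiveCharSet {α : Type*} (M : Matroid α) : Set ℕ :=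
  {p | 0 < p ∧ ∃ (K : Type u) (_ : Field K), CharP K p ∧ MatroidRepresentableOver M K}

/-- `c(M)`: the least positive characteristic of a field over which `M` is representable.
(If there were none, the value would be `0`, which can only lower the maximum below.) -/
noncomputable def leastPosChar {α : Type*} (M : Matroid α) : ℕ :=
  sInf (positiveCharSet.{u} M)

/-- The values `c(M)`, for `M` a representable matroid on `n` elements. -/
def leastPosCharValues (n : ℕ) : Set ℕ :=
  {c | ∃ M : Matroid (Fin n), M.E = Set.univ ∧ MatroidRepresentable.{u} M ∧
    leastPosChar.{u} M = c}

/-- `c(n)`: the maximum of `c(M)` over the representable matroids `M` on `n` elements. -/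
noncomputable def maxLeastPosChar (n : ℕ) : ℕ :=
  sSup (leastPosCharValues.{u} n)

/-- The supremum defining `c(n)` is a genuine maximum. -/
theorem isGreatest_maxLeastPosChar (n : ℕ) :
    IsGreatest (leastPosCharValues.{u} n) (maxLeastPosChar.{u} n) := by
  have hfin : Finite (Matroid (Fin n)) := by
    refine Finite.of_injective
      (fun M : Matroid (Fin n) => (M.E, {I : Set (Fin n) | M.Indep I})) ?_
    intro M N h
    simp only [Prod.mk.injEq] at h
    refine Matroid.ext_indep h.1 fun I _ => ?_
    exact Set.ext_iff.mp h.2 I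
  have hbdd : (leastPosCharValues.{u} n).Finite := by
    refine (Set.finite_range fun M : Matroid (Fin n) => leastPosChar.{u} M).subset ?_
    rintro c ⟨M, -, -, rfl⟩
    exact ⟨M, rfl⟩
  have hne : (leastPosCharValues.{u} n).Nonempty := by
    refine ⟨_, Matroid.loopyOn Set.univ, rfl,
      ⟨ULift.{u} ℚ, inferInstance, 0, fun _ => 0, fun I _ => ?_⟩, rfl⟩
    rw [Matroid.loopyOn_indep_iff]
    constructor
    · rintro rfl
      exact linearIndepOn_empty _ _
    · intro h
      by_contra hI
      obtain ⟨e, he⟩ := Set.nonempty_iff_ne_empty.mpr hI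
      exact h.ne_zero he rfl
  exact ⟨Nat.sSup_mem hne hbdd.bddAbove, fun c hc => le_csSup hbdd.bddAbove hc⟩

/-! A rank-3 matroid with few elements can force a large characteristic, because von Staudt's
constructions carry out arithmetic inside a projective plane. Take a prime `p` with `2 ^ k ≤ p` and
`p + 1 < 2 ^ (k + 1)`. Over `ZMod p`, points on two lines through `X` start at coordinate `1` and
follow the binary digits of `p + 1`: projection from `b` doubles, and returning from `c₀` or `c₁`
adds `0` or `1`. The final coordinate `p + 1` equals `1`, recorded by a collinearity. Any other
representation replays the chain, so `p = 0` there (`natCast_eq_zero_of_chain`) and `p` is the only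
characteristic. This costs `2 * k + 6` points, and Bertrand's postulate supplies `p`. -/

open Submodule

/-! ### Matroids of vector families -/

/-- The matroid on `α` represented by a family of vectors indexed by the finite type `α`. -/
def vectorMatroid {α F V : Type*} [Finite α] [Field F] [AddCommGroup V] [Module F V]
    (w : α → V) : Matroid α :=
  (IndepMatroid.ofFinite (E := Set.univ) Set.finite_univ (fun I => LinearIndepOn F w I)
    (linearIndepOn_empty F w) (fun _ _ hJ hIJ => hJ.mono hIJ)
    (by
      -- Augmentation by dimension: if nothing in `J` extends `I`, the span of `J` lies in that of
      -- `I`, so `J` is no larger.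
      intro I J hI hJ hlt
      by_contra! hcon
      have hsub : span F (w '' J) ≤ span F (w '' I) := by
        refine span_le.2 ?_
        rintro _ ⟨e, he, rfl⟩
        by_cases heI : e ∈ I
        · exact subset_span ⟨e, heI, rfl⟩
        · by_contra hne
          exact hcon e he heI (hI.insert hne)
      have hcard : ∀ S : Set α, LinearIndepOn F w S →
          Module.finrank F (span F (w '' S)) = S.ncard := by
        intro S hS
        have : Fintype S := Fintype.ofFinite S
        have h := finrank_span_eq_card hS
        rw [← Set.image_eq_range] at h
        rw [h, ← Nat.card_eq_fintype_card, Nat.card_coe_set_eq]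
      have : FiniteDimensional F (span F (w '' I)) :=
        FiniteDimensional.span_of_finite F (Set.toFinite _)
      have := Submodule.finrank_mono hsub
      rw [hcard I hI, hcard J hJ] at this
      omega)
    (fun _ _ => Set.subset_univ _)).matroid

theorem vectorMatroid_ground {α F V : Type*} [Finite α] [Field F] [AddCommGroup V] [Module F V]
    (w : α → V) : (vectorMatroid (F := F) w).E = Set.univ := rfl

theorem vectorMatroid_indep_iff {α F V : Type*} [Finite α] [Field F] [AddCommGroup V]
    [Module F V] (w : α → V) (I : Set α) :
    (vectorMatroid (F := F) w).Indep I ↔ LinearIndepOn F w I := Iff.rfl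

/-- Families with the same independent subfamilies have the same closures. -/
theorem mem_span_image_iff_of_linearIndepOn_iff {ι F K V W : Type*} [Field F] [Field K]
    [AddCommGroup V] [Module F V] [AddCommGroup W] [Module K W] {w : ι → V} {v : ι → W}
    (hwv : ∀ I : Set ι, LinearIndepOn F w I ↔ LinearIndepOn K v I)
    {I : Set ι} (hI : LinearIndepOn F w I) (l : ι) :
    w l ∈ span F (w '' I) ↔ v l ∈ span K (v '' I) := by
  by_cases hl : l ∈ I
  · exact ⟨fun _ => subset_span ⟨l, hl, rfl⟩, fun _ => subset_span ⟨l, hl, rfl⟩⟩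
  · have h := hwv (insert l I)
    rw [linearIndepOn_insert hl, linearIndepOn_insert hl] at h
    have := (hwv I).1 hI
    tauto

/-! ### Perspectivities between two lines through a point -/

/-- Two members of the same plane and the same line, the line leaving the plane at `c`, are
proportional. -/
theorem exists_smul_of_mem_of_mem_span_pair {K V : Type*} [Field K] [AddCommGroup V] [Module K V]
    {W : Submodule K V} {c d x q : V} (hc : c ∉ W) (hx : x ∈ W) (hq : q ∈ W)
    (hx' : x ∈ span K {c, d}) (hq' : q ∈ span K {c, d}) (hx0 : x ≠ 0) (hq0 : q ≠ 0) :
    ∃ s : K, s ≠ 0 ∧ x = s • q := by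
  obtain ⟨a, b, rfl⟩ := mem_span_pair.1 hx'
  obtain ⟨a', b', rfl⟩ := mem_span_pair.1 hq'
  have hcoef : ∀ t : K, t • c ∈ W → t = 0 := by
    intro t ht
    by_contra h0
    exact hc ((W.smul_mem_iff h0).1 ht)
  have hb' : b' ≠ 0 := by
    rintro rfl
    rw [zero_smul, add_zero] at hq hq0
    exact hq0 (by rw [hcoef a' hq, zero_smul])
  have hdiff : (a - b / b' * a') • c ∈ W := by
    have := W.sub_mem hx (W.smul_mem (b / b') hq)
    convert this using 1
    rw [smul_add, smul_smul, smul_smul, div_mul_cancel₀ _ hb']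
    module
  have ha := sub_eq_zero.1 (hcoef _ hdiff)
  have hmain : a • c + b • d = (b / b') • (a' • c + b' • d) := by
    rw [smul_add, smul_smul, smul_smul, div_mul_cancel₀ _ hb', ← ha]
  refine ⟨b / b', ?_, hmain⟩
  intro h0
  exact hx0 (by rw [hmain, h0, zero_smul])

theorem linearIndepOn_pair_of {ι F V : Type*} [Field F] [AddCommGroup V] [Module F V]
    (w : ι → V) {i j : ι} (h : ∀ s t : F, s • w i + t • w j = 0 → s = 0 ∧ t = 0) :
    LinearIndepOn F w {i, j} := by
  have hij : i ≠ j := by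
    rintro rfl
    exact one_ne_zero (h 1 (-1) (by module)).1
  exact (LinearIndepOn.pair_iff w hij).2 h

theorem mem_span_pair_of_eq_smul {K V : Type*} [Field K] [AddCommGroup V] [Module K V]
    {x c d c' d' : V} {s t : K} (hx : x ∈ span K {c, d}) (hc : c = s • c') (hd : d = t • d') :
    x ∈ span K {c', d'} := by
  obtain ⟨a, b, rfl⟩ := mem_span_pair.1 hx
  exact mem_span_pair.2 ⟨a * s, b * t, by rw [hc, hd, smul_smul, smul_smul]⟩

section Frame

variable {K V : Type*} [Field K] [AddCommGroup V] [Module K V] {X e f x : V}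

theorem add_smul_notMem_span_pair
    (hlin : ∀ r s t : K, r • X + s • e + t • f = 0 → r = 0 ∧ s = 0 ∧ t = 0) (c : K) :
    f + c • X ∉ span K {X, e} := by
  intro h
  obtain ⟨a, b, hab⟩ := mem_span_pair.1 h
  have := (hlin (a - c) b (-1) (by
    rw [← sub_eq_zero] at hab
    rw [← hab]; module)).2.2
  exact one_ne_zero (neg_eq_zero.1 this)

/-- Subtracting the centre `e - f - b • X` from `e + c • X` leaves `f + (c + b) • X`: passing to the
other line adds `b`. -/
theorem exists_smul_of_projection
    (hlin : ∀ r s t : K, r • X + s • e + t • f = 0 → r = 0 ∧ s = 0 ∧ t = 0) {c b : K}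
    (hx0 : x ≠ 0) (hx : x ∈ span K {X, f}) (hx' : x ∈ span K {e + c • X, e - f - b • X}) :
    ∃ s : K, s ≠ 0 ∧ x = s • (f + (c + b) • X) := by
  have hlin' : ∀ r s t : K, r • X + s • f + t • e = 0 → r = 0 ∧ s = 0 ∧ t = 0 := by
    intro r s t h
    have := hlin r t s (by rw [← h]; abel)
    tauto
  refine exists_smul_of_mem_of_mem_span_pair (add_smul_notMem_span_pair hlin' c) hx ?_ hx' ?_
    hx0 ?_
  · exact mem_span_pair.2 ⟨c + b, 1, by module⟩
  · exact mem_span_pair.2 ⟨1, -1, by module⟩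
  · intro h
    exact one_ne_zero (hlin (c + b) 0 1 (by rw [← h]; module)).2.2

/-- Here the centre is `l • f - e`; subtracting it from `l • (f + c • X)` multiplies the coordinate
by `l`. -/
theorem exists_smul_of_dilation
    (hlin : ∀ r s t : K, r • X + s • e + t • f = 0 → r = 0 ∧ s = 0 ∧ t = 0) {c l : K}
    (hx0 : x ≠ 0) (hx : x ∈ span K {X, e}) (hx' : x ∈ span K {f + c • X, l • f - e}) :
    ∃ s : K, s ≠ 0 ∧ x = s • (e + (l * c) • X) := by
  refine exists_smul_of_mem_of_mem_span_pair (add_smul_notMem_span_pair hlin c) hx ?_ hx' ?_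
    hx0 ?_
  · exact mem_span_pair.2 ⟨l * c, 1, by module⟩
  · exact mem_span_pair.2 ⟨l, -1, by module⟩
  · intro h
    exact one_ne_zero (hlin (l * c) 1 0 (by rw [← h]; module)).2.1

end Frame

/-! ### The chain in an arbitrary representation -/

/-- A family `w` of vectors containing a von Staudt chain for the number `p + 1`, in
characteristic dividing `p`: a family over `K` with the same independent subfamilies exists only
if `p = 0` in `K`. -/
theorem natCast_eq_zero_of_chain {ι F K V : Type*} [Field F] [Field K]
    [AddCommGroup V] [Module K V] {w : ι → Fin 3 → F} {v : ι → V}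
    (hwv : ∀ I : Set ι, LinearIndepOn F w I ↔ LinearIndepOn K v I)
    {X e h c₀ c₁ b : ι} {y z : ℕ → ι} {a : ℕ → ℕ} {m p : ℕ}
    (hX : w X = ![1, 0, 0]) (he : w e = ![0, 1, 0]) (hh : w h = ![2, 0, 1])
    (hc₀ : w c₀ = ![0, 1, -1]) (hc₁ : w c₁ = ![-1, 1, -1]) (hb : w b = ![0, -1, 2])
    (hy : ∀ i ≤ m, w (y i) = ![(a i : F), 0, 1]) (hz : ∀ i ≤ m, w (z i) = ![2 * (a i : F), 1, 0])
    (ha₀ : a 0 = 1) (ha : ∀ i < m, a (i + 1) = 2 * a i ∨ a (i + 1) = 2 * a i + 1)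
    (ham : 2 * a m = p + 1) (hp : (p : F) = 0) : (p : K) = 0 := by
  have hdep : ∀ {i j l : ι}, (∀ s t : F, s • w i + t • w j = 0 → s = 0 ∧ t = 0) →
      (∃ s t : F, s • w i + t • w j = w l) → v l ∈ span K {v i, v j} := by
    intro i j l hij hl
    have := (mem_span_image_iff_of_linearIndepOn_iff hwv (linearIndepOn_pair_of w hij) l).1
      (by rw [Set.image_pair]; exact mem_span_pair.2 hl)
    rwa [Set.image_pair] at this
  have hind : ∀ {i j l : ι}, (∀ s t : F, s • w i + t • w j = 0 → s = 0 ∧ t = 0) →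
      (∀ s t : F, s • w i + t • w j ≠ w l) → v l ∉ span K {v i, v j} := by
    intro i j l hij hl hmem
    rw [← Set.image_pair, ← mem_span_image_iff_of_linearIndepOn_iff hwv
      (linearIndepOn_pair_of w hij) l, Set.image_pair, mem_span_pair] at hmem
    obtain ⟨s, t, hst⟩ := hmem
    exact hl s t hst
  have hpair : ∀ {i j : ι}, (∀ s t : F, s • w i + t • w j = 0 → s = 0 ∧ t = 0) →
      ∀ s t : K, s • v i + t • v j = 0 → s = 0 ∧ t = 0 := by
    intro i j hij
    have hne : i ≠ j := by
      rintro rfl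
      exact one_ne_zero (hij 1 (-1) (by module)).1
    exact (LinearIndepOn.pair_iff v hne).1 ((hwv _).1 (linearIndepOn_pair_of w hij))
  have hg : w (y 0) = ![1, 0, 1] := by rw [hy 0 (Nat.zero_le _), ha₀, Nat.cast_one]
  have hne : ∀ {i : ι}, w i ≠ 0 → v i ≠ 0 := by
    intro i hi h0
    have := (hwv {i}).1 (by simpa using hi)
    simp [h0] at this
  -- A frame in which the points have the expected coordinates.
  obtain ⟨α, β, h₁⟩ := mem_span_pair.1 (hdep (i := e) (j := y 0) (l := c₁)
    (by rw [he, hg]; simp) ⟨1, -1, by rw [he, hg, hc₁]; simp⟩)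
  have hα : α ≠ 0 := by
    rintro rfl
    have := hpair (i := y 0) (j := c₁) (by rw [hg, hc₁]; simp; grind) β (-1) (by rw [← h₁]; module)
    simp at this
  have hβ : β ≠ 0 := by
    rintro rfl
    have := hpair (i := e) (j := c₁) (by rw [he, hc₁]; simp) α (-1) (by rw [← h₁]; module)
    simp at this
  obtain ⟨γ, δ, h₂⟩ := mem_span_pair.1 (hdep (i := X) (j := c₁) (l := c₀)
    (by rw [hX, hc₁]; simp; grind) ⟨1, 1, by rw [hX, hc₁, hc₀]; simp⟩)
  have hγ : γ ≠ 0 := by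
    rintro rfl
    have := hpair (i := c₁) (j := c₀) (by rw [hc₁, hc₀]; simp; grind) δ (-1)
      (by rw [← h₂]; module)
    simp at this
  have hδ : δ ≠ 0 := by
    rintro rfl
    have := hpair (i := X) (j := c₀) (by rw [hX, hc₀]; simp) γ (-1) (by rw [← h₂]; module)
    simp at this
  -- These scalings make `c₁`, `c₀` and `y 0` proportional to `ε - f - x`, `ε - f` and `f + x`.
  obtain ⟨x, hx⟩ : ∃ x, x = (γ / δ) • v X := ⟨_, rfl⟩
  obtain ⟨ε, hε⟩ : ∃ ε, ε = α • v e := ⟨_, rfl⟩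
  obtain ⟨f, hf⟩ : ∃ f, f = (-β) • v (y 0) - x := ⟨_, rfl⟩
  have hvX : v X = (δ / γ) • x := by
    rw [hx, smul_smul]; field_simp; simp
  have hve : v e = α⁻¹ • ε := by
    rw [hε, smul_smul, inv_mul_cancel₀ hα, one_smul]
  have hvg : v (y 0) = (-β⁻¹) • (f + (1 : K) • x) := by
    rw [hf, one_smul, sub_add_cancel, smul_smul]; field_simp; simp
  have hvc₁ : v c₁ = (1 : K) • (ε - f - (1 : K) • x) := by
    rw [← h₁, hf, hε]; module
  have hvc₀ : v c₀ = δ • (ε - f - (0 : K) • x) := by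
    have : γ • v X = δ • x := by rw [hx, smul_smul, mul_div_cancel₀ _ hδ]
    rw [← h₂, this, hvc₁]; module
  have hlin : ∀ r s t : K, r • x + s • ε + t • f = 0 → r = 0 ∧ s = 0 ∧ t = 0 := by
    intro r s t hrst
    have ht : t = 0 := by
      by_contra ht
      refine hind (i := X) (j := e) (l := y 0) (by rw [hX, he]; simp)
        (by rw [hX, he, hg]; simp) (mem_span_pair.2
          ⟨(t * β)⁻¹ * ((r - t) * (γ / δ)), (t * β)⁻¹ * (s * α), ?_⟩)
      have hg' : (t * β) • v (y 0) = (r - t) • x + s • ε := by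
        rw [← sub_eq_zero, ← neg_eq_zero, ← hrst, hf]; module
      rw [hx, hε, smul_smul, smul_smul] at hg'
      rw [mul_smul (t * β)⁻¹, mul_smul (t * β)⁻¹, ← smul_add, ← hg', smul_smul,
        inv_mul_cancel₀ (mul_ne_zero ht hβ), one_smul]
    subst ht
    rw [zero_smul, add_zero, hx, hε, smul_smul, smul_smul] at hrst
    have := hpair (by rw [hX, he]; simp) _ _ hrst
    simp only [mul_eq_zero, div_eq_zero_iff, hγ, hδ, hα, or_false] at this
    exact ⟨this.1, this.2, rfl⟩
  -- Only the position of `b` on the line of `e` and `c₀` stays free; `l` measures it.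
  obtain ⟨l, ⟨σ, hvb⟩⟩ : ∃ l σ : K, v b = σ • (l • f - ε) := by
    obtain ⟨s, t, hst⟩ := mem_span_pair.1 (mem_span_pair_of_eq_smul (hdep (i := e) (j := c₀)
      (l := b) (by rw [he, hc₀]; simp; grind) ⟨1, -2, by rw [he, hc₀, hb]; simp; norm_num⟩)
      hve hvc₀)
    have hne0 : s + t ≠ 0 := by
      intro h0
      refine hind (i := X) (j := y 0) (l := b) (by rw [hX, hg]; simp; grind)
        (by rw [hX, hg, hb]; simp) (mem_span_pair.2 ⟨t * (γ / δ), t * β, ?_⟩)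
      rw [← hst, eq_neg_of_add_eq_zero_left h0, hf, hx]
      module
    refine ⟨t / (s + t), -(s + t), ?_⟩
    rw [← hst, smul_sub (-(s + t)), smul_smul, neg_mul, mul_div_cancel₀ _ hne0]
    module
  have hL₁ : ∀ {i : ι} (c : F), w i = ![c, 1, 0] → v i ∈ span K {x, ε} := by
    intro i c hi
    exact mem_span_pair_of_eq_smul (hdep (i := X) (j := e) (by rw [hX, he]; simp)
      ⟨c, 1, by rw [hX, he, hi]; simp⟩) hvX hve
  have hL₂ : ∀ {i : ι} (c : F), w i = ![c, 0, 1] → v i ∈ span K {x, f} := by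
    intro i c hi
    have := hdep (i := X) (j := y 0) (l := i) (by rw [hX, hg]; simp; grind)
      ⟨c - 1, 1, by rw [hX, hg, hi]; simp⟩
    obtain ⟨s, t, hst⟩ := mem_span_pair.1 (mem_span_pair_of_eq_smul this hvX hvg)
    exact mem_span_pair.2 ⟨s + t, t, by rw [← hst]; module⟩
  have hdil : ∀ i ≤ m, ∀ c s : K, v (y i) = s • (f + c • x) →
      ∃ s : K, s ≠ 0 ∧ v (z i) = s • (ε + (l * c) • x) := by
    intro i hi c s hs
    refine exists_smul_of_dilation hlin (hne ?_) (hL₁ _ (hz i hi)) ?_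
    · rw [hz i hi]; simp
    · refine mem_span_pair_of_eq_smul (hdep ?_ ⟨2, -1, ?_⟩) hs hvb
      · rw [hy i hi, hb]; simp
      · rw [hy i hi, hb, hz i hi]; simp
  have hproj₀ : ∀ {i j : ι} {c : F}, w i = ![c, 1, 0] → w j = ![c, 0, 1] →
      ∀ c s : K, v i = s • (ε + c • x) → ∃ s : K, s ≠ 0 ∧ v j = s • (f + c • x) := by
    intro i j d hi hj c s hs
    have := exists_smul_of_projection hlin (c := c) (b := 0) (x := v j) (hne ?_) (hL₂ _ hj) ?_
    · simpa using this
    · rw [hj]; simp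
    · refine mem_span_pair_of_eq_smul (hdep ?_ ⟨1, -1, ?_⟩) hs hvc₀
      · rw [hi, hc₀]; simp; grind
      · rw [hi, hj, hc₀]; simp
  have hproj₁ : ∀ {i j : ι} {c : F}, w i = ![c, 1, 0] → w j = ![c + 1, 0, 1] →
      ∀ c s : K, v i = s • (ε + c • x) → ∃ s : K, s ≠ 0 ∧ v j = s • (f + (c + 1) • x) := by
    intro i j d hi hj c s hs
    refine exists_smul_of_projection hlin (hne ?_) (hL₂ _ hj) ?_
    · rw [hj]; simp
    · refine mem_span_pair_of_eq_smul (hdep ?_ ⟨1, -1, ?_⟩) hs hvc₁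
      · rw [hi, hc₁]; simp; grind
      · rw [hi, hj, hc₁]; simp
  -- The last point of the chain is the unit of the first line.
  have hone : w (z m) = ![1, 1, 0] := by
    have : (2 * (a m : F)) = 1 := by
      have := congrArg (Nat.cast : ℕ → F) ham
      push_cast at this
      rw [this, hp, zero_add]
    rw [hz m le_rfl, this]
  obtain ⟨τ, hτ, hvz⟩ : ∃ s : K, s ≠ 0 ∧ v (z m) = s • (ε + (1 : K) • x) := by
    have hlin' : ∀ r s t : K, r • x + s • f + t • ε = 0 → r = 0 ∧ s = 0 ∧ t = 0 := by
      intro r s t h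
      have := hlin r t s (by rw [← h]; abel)
      tauto
    -- The projection from `c₀` run backwards, with `ε` and `f` exchanged.
    have := exists_smul_of_projection hlin' (c := 1) (b := 0) (x := v (z m)) (hne ?_)
      (hL₁ _ hone) ?_
    · simpa using this
    · rw [hone]; simp
    · refine mem_span_pair_of_eq_smul (hdep (i := y 0) (j := c₀) ?_ ⟨1, 1, ?_⟩) hvg
        (t := -δ) (by rw [hvc₀]; module)
      · rw [hg, hc₀]; simp
      · rw [hg, hc₀, hone]; simp
  -- The dilation ratio is two.
  have hl : l = 2 := by
    -- The point `h` is reached twice: by doubling `1`, giving coordinate `l`, and by adding `1` to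
    -- `1`.
    obtain ⟨s₁, -, hs₁⟩ := hdil 0 (Nat.zero_le _) 1 _ hvg
    obtain ⟨s₂, hs₂0, hs₂⟩ := hproj₀ (i := z 0) (j := h) (c := 2)
      (by rw [hz 0 (Nat.zero_le _), ha₀]; simp) hh _ _ hs₁
    have := mem_span_pair_of_eq_smul (hdep (i := z m) (j := c₁) (l := h)
      (by rw [hone, hc₁]; simp; grind) ⟨1, -1, by rw [hone, hc₁, hh]; simp; norm_num⟩)
      hvz hvc₁
    obtain ⟨s, t, hst⟩ := mem_span_pair.1 this
    obtain ⟨e₁, e₂, e₃⟩ := hlin (s - t - s₂ * (l * 1)) (s + t) (-t - s₂) (by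
      rw [← sub_eq_zero, hs₂] at hst
      rw [← hst]; module)
    have : s₂ * (l - 2) = 0 := by linear_combination -e₁ + e₂ + 2 * e₃
    exact sub_eq_zero.1 ((mul_eq_zero.1 this).resolve_left hs₂0)
  subst hl
  have hchain : ∀ i ≤ m, ∃ s : K, v (y i) = s • (f + (a i : K) • x) := by
    intro i
    induction i with
    | zero => exact fun _ => ⟨_, by rw [hvg, ha₀, Nat.cast_one]⟩
    | succ i ih =>
      intro hi
      obtain ⟨s, hs⟩ := ih (by omega)
      obtain ⟨s', -, hs'⟩ := hdil i (by omega) _ _ hs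
      rcases ha i (by omega) with hai | hai
      · obtain ⟨s'', -, h''⟩ := hproj₀ (j := y (i + 1)) (hz i (by omega))
          (by rw [hy _ hi, hai]; push_cast; rfl) _ _ hs'
        exact ⟨s'', by rw [h'', hai]; push_cast; rfl⟩
      · obtain ⟨s'', -, h''⟩ := hproj₁ (j := y (i + 1)) (hz i (by omega))
          (by rw [hy _ hi, hai]; push_cast; rfl) _ _ hs'
        exact ⟨s'', by rw [h'', hai]; push_cast; rfl⟩
  obtain ⟨s, hs⟩ := hchain m le_rfl
  obtain ⟨s', -, hs'⟩ := hdil m le_rfl _ _ hs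
  have hcast : (2 * (a m : K)) = p + 1 := by exact_mod_cast congrArg (Nat.cast : ℕ → K) ham
  -- `z m` has coordinate `1` by its collinearity and `p + 1` by the chain.
  rw [hvz, hcast] at hs'
  obtain ⟨e₁, e₂, -⟩ := hlin (τ - s' * (p + 1)) (τ - s') 0 (by
    rw [← sub_eq_zero] at hs'
    rw [← hs']; module)
  have : τ * p = 0 := by linear_combination -e₁ + (p + 1) * e₂
  exact (mul_eq_zero.1 this).resolve_left hτ

/-! ### The matroids and the bound -/

/-- The vectors of a von Staudt chain: a projective frame with three centres of projection,
followed by the points with coordinates `a i` and `2 * a i` on two lines alternately. -/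
def chainVector (F : Type*) [Field F] (a : ℕ → ℕ) : ℕ → Fin 3 → F
  | 0 => ![1, 0, 0]
  | 1 => ![0, 1, 0]
  | 2 => ![2, 0, 1]
  | 3 => ![0, 1, -1]
  | 4 => ![-1, 1, -1]
  | 5 => ![0, -1, 2]
  | j + 6 => if j % 2 = 0 then ![(a (j / 2) : F), 0, 1] else ![2 * (a (j / 2) : F), 1, 0]

theorem chainVector_even (F : Type*) [Field F] (a : ℕ → ℕ) (i : ℕ) :
    chainVector F a (2 * i + 6) = ![(a i : F), 0, 1] := by
  simp [chainVector]

theorem chainVector_odd (F : Type*) [Field F] (a : ℕ → ℕ) (i : ℕ) :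
    chainVector F a (2 * i + 1 + 6) = ![2 * (a i : F), 1, 0] := by
  have h₁ : (2 * i + 1) % 2 = 1 := by omega
  have h₂ : (2 * i + 1) / 2 = i := by omega
  simp [chainVector, h₁, h₂]

theorem vectorMatroid_representableOver {α F : Type*} [Finite α] [Field F] {r : ℕ}
    (w : α → Fin r → F) : MatroidRepresentableOver (vectorMatroid (F := F) w) F :=
  ⟨r, w, fun I _ => vectorMatroid_indep_iff w I⟩

theorem two_le_of_mem_positiveCharSet {α : Type*} {M : Matroid α} {q : ℕ}
    (hq : q ∈ positiveCharSet.{u} M) : 2 ≤ q := by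
  obtain ⟨hpos, K, _, _, -⟩ := hq
  have : q ≠ 1 := CharP.char_ne_one K q
  omega

theorem leastPosChar_le_maxLeastPosChar {n : ℕ} {F : Type u} [Field F] {r : ℕ}
    (w : Fin n → Fin r → F) :
    leastPosChar.{u} (vectorMatroid (F := F) w) ≤ maxLeastPosChar.{u} n :=
  (isGreatest_maxLeastPosChar n).2
    ⟨_, vectorMatroid_ground w, ⟨F, inferInstance, vectorMatroid_representableOver w⟩, rfl⟩

theorem leastPosChar_vectorMatroid_mem {n p : ℕ} (hp : 0 < p) {F : Type u} [Field F] [CharP F p]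
    {r : ℕ} (w : Fin n → Fin r → F) :
    leastPosChar.{u} (vectorMatroid (F := F) w) ∈
      positiveCharSet.{u} (vectorMatroid (F := F) w) :=
  Nat.sInf_mem ⟨p, hp, F, inferInstance, inferInstance, vectorMatroid_representableOver w⟩

theorem two_le_maxLeastPosChar (n : ℕ) : 2 ≤ maxLeastPosChar.{u} n := by
  have : Fact (Nat.Prime 2) := ⟨Nat.prime_two⟩
  let w : Fin n → Fin 0 → ULift.{u} (ZMod 2) := 0
  exact (two_le_of_mem_positiveCharSet (leastPosChar_vectorMatroid_mem two_pos w)).trans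
    (leastPosChar_le_maxLeastPosChar w)

/-- A prime `p` with `k + 1` binary digits, such that `p + 1` also has `k + 1` digits, is the only
characteristic of some matroid on `n ≥ 2 * k + 6` elements. -/
theorem le_maxLeastPosChar_of_prime {n k p : ℕ} (hp : p.Prime) (hp2 : p ≠ 2) (hk : 1 ≤ k)
    (hle : 2 ^ k ≤ p) (hlt : p + 1 < 2 ^ (k + 1)) (hn : 2 * k + 6 ≤ n) :
    p ≤ maxLeastPosChar.{u} n := by
  have : Fact p.Prime := ⟨hp⟩
  let F := ULift.{u} (ZMod p)
  -- For `i ≤ k`, the number formed by the leading `i + 1` binary digits of `p + 1`.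
  let a : ℕ → ℕ := fun i => (p + 1) / 2 ^ (k - i)
  let w : Fin n → Fin 3 → F := fun j => chainVector F a j
  have hmem := leastPosChar_vectorMatroid_mem hp.pos w
  refine le_trans (le_of_eq ?_) (leastPosChar_le_maxLeastPosChar w)
  obtain ⟨hpos, K, _, _, r, v, hv⟩ := hmem
  generalize leastPosChar.{u} (vectorMatroid (F := F) w) = q at *
  have hwv : ∀ I : Set (Fin n), LinearIndepOn F w I ↔ LinearIndepOn K v I := fun I =>
    (vectorMatroid_indep_iff w I).symm.trans (hv I (Set.subset_univ I))
  have hn0 : 0 < n := by omega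
  have hidx : ∀ j < n, w ⟨j % n, Nat.mod_lt _ hn0⟩ = chainVector F a j := fun j hj => by
    simp only [w, Nat.mod_eq_of_lt hj]
  have hcast : (p : K) = 0 := by
    refine natCast_eq_zero_of_chain hwv (m := k - 1) (a := a)
      -- Reduction mod `n` only makes `y` and `z` total; the indices used are below `n`.
      (y := fun i => ⟨(2 * i + 6) % n, Nat.mod_lt _ hn0⟩)
      (z := fun i => ⟨(2 * i + 1 + 6) % n, Nat.mod_lt _ hn0⟩)
      (hidx 0 (by omega)) (hidx 1 (by omega)) (hidx 2 (by omega)) (hidx 3 (by omega))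
      (hidx 4 (by omega)) (hidx 5 (by omega))
      (fun i hi => (hidx _ (by omega)).trans (chainVector_even F a i))
      (fun i hi => (hidx _ (by omega)).trans (chainVector_odd F a i)) ?_ ?_ ?_ ?_
    · rw [pow_succ] at hlt
      exact Nat.div_eq_of_lt_le (by rw [Nat.sub_zero]; omega) (by rw [Nat.sub_zero]; omega)
    · intro i hi
      have hki : k - i = (k - (i + 1)) + 1 := by omega
      have : a i = a (i + 1) / 2 := by
        simp only [a]
        rw [hki, pow_succ, Nat.div_div_eq_div_mul]
      omega
    · have hodd := hp.eq_two_or_odd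
      have hk1 : k - (k - 1) = 1 := by omega
      simp only [a, hk1, pow_one]
      omega
    · exact CharP.cast_eq_zero F p
  have hdvd : q ∣ p := (CharP.cast_eq_zero_iff K q p).1 hcast
  have hq1 : q ≠ 1 := CharP.char_ne_one K q
  exact (((Nat.dvd_prime hp).1 hdvd).resolve_left hq1).symm

theorem theorem4p1 (n : ℕ) (hn : 1 ≤ n) :
    Real.logb 2 (maxLeastPosChar.{u} n : ℝ) ≥ ((n : ℝ) - 7) / 2 := by
  have hlog : ∀ k : ℕ, 2 ^ k ≤ maxLeastPosChar.{u} n →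
      (k : ℝ) ≤ Real.logb 2 (maxLeastPosChar.{u} n) := by
    intro k hk
    have hk' : (2 : ℝ) ^ k ≤ (maxLeastPosChar.{u} n : ℝ) := by exact_mod_cast hk
    rw [Real.le_logb_iff_rpow_le one_lt_two (lt_of_lt_of_le (by positivity) hk'),
      Real.rpow_natCast]
    exact hk'
  rcases le_or_gt n 9 with h9 | h9
  -- For `n ≤ 9` the bound is at most `1`, and every characteristic is at least `2`.
  · have h1 := hlog 1 (two_le_maxLeastPosChar n)
    have : (n : ℝ) ≤ 9 := by exact_mod_cast h9
    push_cast at h1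
    linarith
  · obtain ⟨k, hk, hkn, hnk⟩ : ∃ k, 2 ≤ k ∧ 2 * k + 6 ≤ n ∧ n ≤ 2 * k + 7 :=
      ⟨(n - 6) / 2, by omega, by omega, by omega⟩
    have h4 : 2 ^ 2 ≤ 2 ^ k := Nat.pow_le_pow_right two_pos hk
    -- Starting Bertrand at `2 ^ k - 1` gives `p ≤ 2 ^ (k + 1) - 2`, so `p + 1` keeps `k + 1`
    -- digits.
    obtain ⟨p, hp, hlt, hle⟩ := Nat.exists_prime_lt_and_le_two_mul (2 ^ k - 1) (by omega)
    have hlog' := hlog k (le_trans (by omega) (le_maxLeastPosChar_of_prime (n := n) (k := k) hp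
      (by omega) (by omega) (by omega) (by rw [pow_succ]; omega) hkn))
    have : (n : ℝ) ≤ 2 * k + 7 := by exact_mod_cast hnk
    linarith
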